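/- Let $K\subset\mathbb{R}^d$ be compact with Lebesgue-negligible boundary, let $\mathcal{P}(K)$ be the set of Borel probability measures on $K$, and let $\mathcal{D}:\mathcal{P}(K)\times\mathcal{P}(K)\to[0,\infty]$ satisfy $\mathcal{D}(\mu,\mu)=0$ for all $\mu\in\mathcal{P}(K)$. Let $\mathbb{P},\mathbb{Q}\in\mathcal{P}(K)$ with $\mathbb{P}$ absolutely continuous with respect to Lebesgue measure, let $\lambda>0$, $p>1$ and $c(x,y)=\|x-y\|^p$ with the Euclidean norm. For measurable $T:K\to K$ put $$\mathcal{G}(T)=\mathcal{D}(T_\#\mathbb{P},\mathbb{Q})+\lambda\int_K c(x,T(x))\,d\mathbb{P}(x),$$ and for $\mathbb{Q}'\in\mathcal{P}(K)$ put $$\mathcal{F}(\mathbb{Q}')=\mathcal{D}(\mathbb{Q}',\mathbb{Q})+\lambda\,\mathrm{Cost}(\mathbb{P},\mathbb{Q}'),\qquad \mathrm{Cost}(\mathbb{P},\mathbb{Q}')=\inf_{\pi\in\Pi(\mathbb{P},\mathbb{Q}')}\int_{K\times K} c\,d\pi,$$ where $\Pi(\mathbb{P},\mathbb{Q}')$ is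 the set of measures on $K\times K$ with marginals $\mathbb{P}$ and $\mathbb{Q}'$. Then: 1. For all $\mathbb{Q}'\in\mathcal{P}(K)$, $\mathrm{Cost}(\mathbb{P},\mathbb{Q}')$ is also equal to Monge's cost $\inf_{T_\#\mathbb{P}=\mathbb{Q}'}\int_K c(x,T(x))\,d\mathbb{P}(x)$, the infimum being over measurable $T:K\to K$. 2. The regularized GAN problem has the same value as the problem over distributions: $$\inf_{T:K\to K\text{ measurable}}\mathcal{G}(T)=\inf_{\mathbb{Q}'\in\mathcal{P}(K)}\mathcal{F}(\mathbb{Q}').$$ 3. A measurable $T:K\to K$ minimizes $\mathcal{G}$ if and only if $T_\#\mathbb{P}$ minimizes $\mathcal{F}$ and $T$ is an optimal transport map from $\mathbb{P}$ to $T_\#\mathbb{P}$, that is, $\int_K c(x,T(x))\,d\mathbb{P}(x)=\mathrm{Cost}(\mathbb{P},T_\#\mathbb{P})$. In particular, if $T^\lambda$ minimizes $\mathcal{G}$, then $\mathbb{Q}^\lambda=T^\lambda_\#\mathbb{P}$ minimizes $\mathcal{F}$. 4. Conversely, if $\mathbb{Q}^\lambda$ minimizes $\mathcal{F}$, then there is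 a minimizer $T^\lambda$ of $\mathcal{G}$ with $T^\lambda_\#\mathbb{P}=\mathbb{Q}^\lambda$, and it is unique up to equality $\mathbb{P}$-almost everywhere. -/

import Mathlib

open MeasureTheory Set
open scoped ENNReal

namespace RegGAN

noncomputable section

/-- The cost `c(x, y) = ‖x - y‖ ^ p` (Euclidean norm) on a subset `K` of `ℝ^d`. -/
def powCost {d : ℕ} (K : Set (EuclideanSpace ℝ (Fin d))) (p : ℝ) (x y : K) : ℝ≥0∞ :=
  ENNReal.ofReal (‖(x : EuclideanSpace ℝ (Fin d)) - (y : EuclideanSpace ℝ (Fin d))‖ ^ p)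

/-- Measurable maps `T : X → Y`. -/
abbrev MeasMap (X Y : Type*) [MeasurableSpace X] [MeasurableSpace Y] : Type _ :=
  {T : X → Y // Measurable T}

variable {X Y : Type*} [MeasurableSpace X] [MeasurableSpace Y]

/-- The push-forward `T_# P`. -/
def pushforward (P : ProbabilityMeasure X) (T : MeasMap X Y) : ProbabilityMeasure Y :=
  P.map T.2.aemeasurable

/-- The content loss `R_c(T) = ∫ c(x, T x) dP(x)`. -/
def contentLoss (c : X → Y → ℝ≥0∞) (P : ProbabilityMeasure X) (T : MeasMap X Y) : ℝ≥0∞ :=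
  ∫⁻ x, c x (T.1 x) ∂(P : Measure X)

/-- Monge's optimal transport cost: the infimum of `∫ c(x, T x) dP(x)` over the measurable maps
`T` with `T_# P = R`; it is `∞` if there is no such map. -/
def mongeCost (c : X → Y → ℝ≥0∞) (P : ProbabilityMeasure X) (R : ProbabilityMeasure Y) : ℝ≥0∞ :=
  ⨅ (T : MeasMap X Y) (_ : pushforward P T = R), contentLoss c P T

/-- Kantorovich's optimal transport cost: the infimum of `∫ c dπ` over the transport plans `π`,
the measures on `X × Y` with marginals `P` and `R`. -/
def kantorovichCost (c : X → Y → ℝ≥0∞) (P : ProbabilityMeasure X) (R : ProbabilityMeasure Y) :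
    ℝ≥0∞ :=
  ⨅ (π : Measure (X × Y)) (_ : π.fst = (P : Measure X)) (_ : π.snd = (R : Measure Y)),
    ∫⁻ z, c z.1 z.2 ∂π

/-- The objective of the regularized GAN, `T ↦ D(T_# P, Q) + lam * R_c(T)`. -/
def ganObjective (D : ProbabilityMeasure Y → ProbabilityMeasure Y → ℝ≥0∞) (lam : ℝ)
    (c : X → Y → ℝ≥0∞) (P : ProbabilityMeasure X) (Q : ProbabilityMeasure Y)
    (T : MeasMap X Y) : ℝ≥0∞ :=
  D (pushforward P T) Q + ENNReal.ofReal lam * contentLoss c P T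

/-- The objective over distributions, `F(R) = D(R, Q) + lam * Cost(P, R)`. -/
def distObjective (D : ProbabilityMeasure Y → ProbabilityMeasure Y → ℝ≥0∞) (lam : ℝ)
    (c : X → Y → ℝ≥0∞) (P : ProbabilityMeasure X) (Q : ProbabilityMeasure Y)
    (R : ProbabilityMeasure Y) : ℝ≥0∞ :=
  D R Q + ENNReal.ofReal lam * kantorovichCost c P R

end

end RegGAN

/-! Everything reduces to a theorem of Brenier and Gangbo–McCann type,
`RegGAN.exists_unique_optimal_map`: from `P` to any `R` there is an optimal transport map, unique
almost everywhere, of finite cost. Since the graph of `T` is a transport plan, `F(T_# P) ≤ G(T)`,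
with equality when `T` is optimal; as every `R` is reached by an optimal map, values and minimizers
correspond.

The optimal map comes from duality. Hahn–Banach and Riesz produce a plan without duality gap
(`exists_plan_forall_lt_dual`), and Arzelà–Ascoli yields optimal potentials `φ`, `ψ`
(`exists_plan_eq_dual`). By complementary slackness every optimal plan lives where `φ x + ψ y = c
(x, y)`. There `x` minimizes `x' ↦ ‖x' - y‖ ^ p - f x'`, where `f` is the transform of `ψ`. By
Rademacher `f` is differentiable almost everywhere, and the first-order condition determines `y`
from the gradient of `f` at `x`, because the gradient of `‖·‖ ^ p` is injective for `p > 1`. So all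
optimal plans lie on one graph. -/

/-! ### Hahn–Banach and Riesz representation -/

theorem exists_linearMap_le_sublinear_apply_eq {E : Type*} [AddCommGroup E] [Module ℝ E]
    (q : E → ℝ) (hsmul : ∀ c : ℝ, 0 < c → ∀ x, q (c • x) = c * q x)
    (hadd : ∀ x y, q (x + y) ≤ q x + q y) (u : E) :
    ∃ g : E →ₗ[ℝ] ℝ, g u = q u ∧ ∀ x, g x ≤ q x := by
  have h0 : q 0 = 0 := by
    have := hsmul 2 (by norm_num) 0
    rw [smul_zero] at this
    linarith
  -- `u` may vanish, so `t • u ↦ t * q u` needs a check that it is well defined.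
  have H : ∀ c : ℝ, c • u = 0 → (RingHom.id ℝ) c • q u = 0 := by
    intro c hc
    rcases smul_eq_zero.1 hc with h | h
    · simp [h]
    · simp [h, h0]
  obtain ⟨g, hg, hle⟩ := exists_extension_of_le_sublinear
    (LinearPMap.mkSpanSingleton' u (q u) H) q hsmul hadd (by
      rintro ⟨x, hx⟩
      obtain ⟨t, rfl⟩ := Submodule.mem_span_singleton.1 hx
      rw [LinearPMap.mkSpanSingleton'_apply]
      simp only [RingHom.id_apply, smul_eq_mul]
      rcases lt_trichotomy t 0 with ht | rfl | ht
      · have h1 := hadd (t • u) ((-t) • u)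
        rw [← add_smul, add_neg_cancel, zero_smul, h0, hsmul (-t) (by linarith)] at h1
        linarith
      · simp [h0]
      · rw [hsmul t ht])
  refine ⟨g, ?_, hle⟩
  have := hg ⟨u, Submodule.mem_span_singleton_self u⟩
  exact this.trans (LinearPMap.mkSpanSingleton'_apply_self u (q u) H _)

theorem exists_measure_integral_eq_of_nonneg {Z : Type*} [TopologicalSpace Z] [CompactSpace Z]
    [T2Space Z] [MeasurableSpace Z] [BorelSpace Z] (g : C(Z, ℝ) →ₗ[ℝ] ℝ)
    (hg : ∀ u, 0 ≤ u → 0 ≤ g u) :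
    ∃ μ : Measure Z, IsFiniteMeasure μ ∧ ∀ u : C(Z, ℝ), ∫ z, u z ∂μ = g u := by
  let Λ₀ : CompactlySupportedContinuousMap Z ℝ →ₗ[ℝ] ℝ :=
    { toFun := fun f => g (f : C(Z, ℝ))
      map_add' := fun f₁ f₂ => g.map_add (f₁ : C(Z, ℝ)) (f₂ : C(Z, ℝ))
      map_smul' := fun c f => g.map_smul c (f : C(Z, ℝ)) }
  let Λ : CompactlySupportedContinuousMap Z ℝ →ₚ[ℝ] ℝ :=
    PositiveLinearMap.mk₀ Λ₀ (fun f hf => hg _ hf)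
  refine ⟨RealRMK.rieszMeasure Λ, ⟨?_⟩, fun u => ?_⟩
  · exact isCompact_univ.measure_lt_top
  · exact RealRMK.integral_rieszMeasure Λ (CompactlySupportedContinuousMap.continuousMapEquiv u)

/-! ### Kantorovich duality without gap -/

section Duality

variable {X Y : Type*} [MetricSpace X] [CompactSpace X] [MeasurableSpace X] [BorelSpace X]
  [MetricSpace Y] [CompactSpace Y] [MeasurableSpace Y] [BorelSpace Y]

theorem ContinuousMap.integrable_of_compactSpace (μ : Measure X) [IsFiniteMeasure μ]
    (f : C(X, ℝ)) : Integrable f μ :=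
  f.continuous.integrable_of_hasCompactSupport (HasCompactSupport.of_compactSpace f)

theorem integral_add_of_marginals {μ : Measure X} {ν : Measure Y} {π : Measure (X × Y)}
    [IsFiniteMeasure π] (h1 : π.fst = μ) (h2 : π.snd = ν) (φ : C(X, ℝ)) (ψ : C(Y, ℝ)) :
    ∫ z, (φ z.1 + ψ z.2) ∂π = ∫ x, φ x ∂μ + ∫ y, ψ y ∂ν := by
  subst h1 h2
  rw [integral_add, Measure.fst, Measure.snd, integral_map, integral_map]
  · exact measurable_snd.aemeasurable
  · exact ψ.continuous.aestronglyMeasurable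
  · exact measurable_fst.aemeasurable
  · exact φ.continuous.aestronglyMeasurable
  · exact (φ.comp ContinuousMap.fst).integrable_of_compactSpace π
  · exact (ψ.comp ContinuousMap.snd).integrable_of_compactSpace π

theorem integral_add_le_integral_of_marginals {μ : Measure X} {ν : Measure Y}
    {π : Measure (X × Y)} [IsFiniteMeasure π] (h1 : π.fst = μ) (h2 : π.snd = ν)
    (c : C(X × Y, ℝ)) (φ : C(X, ℝ)) (ψ : C(Y, ℝ)) (h : ∀ x y, φ x + ψ y ≤ c (x, y)) :
    ∫ x, φ x ∂μ + ∫ y, ψ y ∂ν ≤ ∫ z, c z ∂π := by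
  rw [← integral_add_of_marginals h1 h2]
  refine integral_mono ?_ (c.integrable_of_compactSpace π) fun z => h z.1 z.2
  exact ((φ.comp ContinuousMap.fst).integrable_of_compactSpace π).add
    ((ψ.comp ContinuousMap.snd).integrable_of_compactSpace π)

/-- Kantorovich duality on compact spaces: some transport plan has a cost which is not greater
than any upper bound of the dual problem. -/
theorem exists_plan_forall_lt_dual (μ : Measure X) (ν : Measure Y) [IsProbabilityMeasure μ]
    [IsProbabilityMeasure ν] (c : C(X × Y, ℝ)) :
    ∃ π : Measure (X × Y), π.fst = μ ∧ π.snd = ν ∧ ∀ a < ∫ z, c z ∂π,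
      ∃ (φ : C(X, ℝ)) (ψ : C(Y, ℝ)), (∀ x y, φ x + ψ y ≤ c (x, y)) ∧
        a < ∫ x, φ x ∂μ + ∫ y, ψ y ∂ν := by
  -- The infimum `q u` of `A u` is the least price of a separable majorant of `u`. It is sublinear,
  -- and `-q (-c)` is the value of the dual problem.
  let A : C(X × Y, ℝ) → Set ℝ := fun u => {r | ∃ (φ : C(X, ℝ)) (ψ : C(Y, ℝ)),
    (∀ x y, u (x, y) ≤ φ x + ψ y) ∧ r = ∫ x, φ x ∂μ + ∫ y, ψ y ∂ν}
  have hne : ∀ u, (A u).Nonempty := fun u =>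
    ⟨_, ContinuousMap.const X ‖u‖, 0, fun x y => by
      simpa using (le_abs_self _).trans (u.norm_coe_le_norm (x, y)), rfl⟩
  have hbdd : ∀ u, BddBelow (A u) := by
    intro u
    -- Any plan bounds the prices from below; the product is one.
    refine ⟨∫ z, u z ∂(μ.prod ν), ?_⟩
    rintro _ ⟨φ, ψ, h, rfl⟩
    have := integral_add_le_integral_of_marginals (μ := μ) (ν := ν) (π := μ.prod ν)
      (by simp) (by simp) (-u) (-φ) (-ψ) (fun x y => by
        have := h x y
        simp only [ContinuousMap.neg_apply]
        linarith)
    simp only [ContinuousMap.neg_apply, integral_neg] at this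
    linarith
  let q : C(X × Y, ℝ) → ℝ := fun u => sInf (A u)
  have hq : ∀ u, ∀ r ∈ A u, q u ≤ r := fun u r hr => csInf_le (hbdd u) hr
  have hq' : ∀ u b, (∀ r ∈ A u, b ≤ r) → b ≤ q u := fun u b h => le_csInf (hne u) h
  have hadd : ∀ u v, q (u + v) ≤ q u + q v := by
    intro u v
    have h1 : q (u + v) - q u ≤ q v := by
      refine hq' _ _ ?_
      rintro _ ⟨φ, ψ, h, rfl⟩
      have h2 : q (u + v) - (∫ x, φ x ∂μ + ∫ y, ψ y ∂ν) ≤ q u := by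
        refine hq' _ _ ?_
        rintro _ ⟨φ', ψ', h', rfl⟩
        have := hq (u + v) _ ⟨φ' + φ, ψ' + ψ, fun x y => by
          have := h x y
          have := h' x y
          simp only [ContinuousMap.add_apply]
          linarith, rfl⟩
        simp only [ContinuousMap.add_apply] at this
        rw [integral_add (φ'.integrable_of_compactSpace μ) (φ.integrable_of_compactSpace μ),
          integral_add (ψ'.integrable_of_compactSpace ν) (ψ.integrable_of_compactSpace ν)] at this
        linarith
      linarith
    linarith
  have hsmul_le : ∀ t : ℝ, 0 < t → ∀ u, q (t • u) ≤ t * q u := by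
    intro t ht u
    rw [← div_le_iff₀' ht]
    refine hq' _ _ ?_
    rintro _ ⟨φ, ψ, h, rfl⟩
    rw [div_le_iff₀' ht]
    have := hq (t • u) _ ⟨t • φ, t • ψ, fun x y => by
      have := mul_le_mul_of_nonneg_left (h x y) ht.le
      simp only [ContinuousMap.smul_apply, smul_eq_mul]
      linarith, rfl⟩
    simp only [ContinuousMap.smul_apply, smul_eq_mul, integral_const_mul] at this
    linarith
  have hsmul : ∀ t : ℝ, 0 < t → ∀ u, q (t • u) = t * q u := by
    intro t ht u
    refine le_antisymm (hsmul_le t ht u) ?_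
    have := hsmul_le t⁻¹ (inv_pos.2 ht) (t • u)
    rw [smul_smul, inv_mul_cancel₀ ht.ne', one_smul] at this
    calc t * q u ≤ t * (t⁻¹ * q (t • u)) := by gcongr
      _ = q (t • u) := by field_simp
  -- Touching `q` at `-c` makes `g c` the dual value. The bound `g ≤ q` forces the marginals (apply
  -- it to a separable function and to its negative) and positivity.
  obtain ⟨g, hgc, hgle⟩ := exists_linearMap_le_sublinear_apply_eq q hsmul hadd (-c)
  have hsplit_le : ∀ (φ : C(X, ℝ)) (ψ : C(Y, ℝ)),
      g (φ.comp ContinuousMap.fst + ψ.comp ContinuousMap.snd) ≤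
        ∫ x, φ x ∂μ + ∫ y, ψ y ∂ν := fun φ ψ =>
    (hgle _).trans (hq _ _ ⟨φ, ψ, fun x y => le_rfl, rfl⟩)
  have hsplit : ∀ (φ : C(X, ℝ)) (ψ : C(Y, ℝ)),
      g (φ.comp ContinuousMap.fst + ψ.comp ContinuousMap.snd) =
        ∫ x, φ x ∂μ + ∫ y, ψ y ∂ν := by
    intro φ ψ
    refine le_antisymm (hsplit_le φ ψ) ?_
    have h := hsplit_le (-φ) (-ψ)
    have e : (-φ).comp ContinuousMap.fst + (-ψ).comp ContinuousMap.snd =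
        -(φ.comp ContinuousMap.fst + ψ.comp ContinuousMap.snd : C(X × Y, ℝ)) := by
      ext z
      simp only [ContinuousMap.add_apply, ContinuousMap.comp_apply, ContinuousMap.neg_apply]
      ring
    rw [e, map_neg] at h
    simp only [ContinuousMap.neg_apply, integral_neg] at h
    linarith
  obtain ⟨π, hπ, hint⟩ := exists_measure_integral_eq_of_nonneg g (by
    intro u hu
    have h1 : q (-u) ≤ 0 := hq _ _ ⟨0, 0, fun x y => by simpa using hu (x, y), by simp⟩
    have h2 := hgle (-u)
    rw [map_neg] at h2
    linarith)
  refine ⟨π, ?_, ?_, fun a ha => ?_⟩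
  · refine ext_of_forall_integral_eq_of_IsFiniteMeasure fun f => ?_
    have h := hsplit f.toContinuousMap 0
    rw [← hint] at h
    rw [Measure.fst, integral_map measurable_fst.aemeasurable
      f.continuous.aestronglyMeasurable]
    simpa using h
  · refine ext_of_forall_integral_eq_of_IsFiniteMeasure fun f => ?_
    have h := hsplit 0 f.toContinuousMap
    rw [← hint] at h
    rw [Measure.snd, integral_map measurable_snd.aemeasurable
      f.continuous.aestronglyMeasurable]
    simpa using h
  · have h1 : q (-c) < -a := by
      rw [← hgc, map_neg, ← hint]
      linarith
    obtain ⟨_, ⟨φ, ψ, h, rfl⟩, hlt⟩ := exists_lt_of_csInf_lt (hne _) h1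
    refine ⟨-φ, -ψ, fun x y => ?_, ?_⟩
    · have := h x y
      simp only [ContinuousMap.neg_apply] at this ⊢
      linarith
    · simp only [ContinuousMap.neg_apply, integral_neg]
      linarith

end Duality

/-! ### Lipschitz infima and attainment in the dual problem -/

theorem LipschitzOnWith.iInf_of_bddBelow {ι X : Type*} [Nonempty ι] [PseudoMetricSpace X]
    {L : NNReal} {s : Set X} {f : ι → X → ℝ} (hf : ∀ i, LipschitzOnWith L (f i) s)
    (hb : ∀ x ∈ s, BddBelow (range fun i => f i x)) :
    LipschitzOnWith L (fun x => ⨅ i, f i x) s := by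
  refine LipschitzOnWith.of_le_add_mul L fun x hx y hy => ?_
  rw [← sub_le_iff_le_add]
  refine le_ciInf fun i => ?_
  have h1 : ⨅ i, f i x ≤ f i x := ciInf_le (hb x hx) i
  have h2 := (hf i).dist_le_mul x hx y hy
  rw [Real.dist_eq] at h2
  linarith [le_abs_self (f i x - f i y)]

theorem LipschitzWith.iInf_of_bddBelow {ι X : Type*} [Nonempty ι] [PseudoMetricSpace X]
    {L : NNReal} {f : ι → X → ℝ} (hf : ∀ i, LipschitzWith L (f i))
    (hb : ∀ x, BddBelow (range fun i => f i x)) :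
    LipschitzWith L (fun x => ⨅ i, f i x) := by
  rw [← lipschitzOnWith_univ]
  exact LipschitzOnWith.iInf_of_bddBelow (fun i => (hf i).lipschitzOnWith) fun x _ => hb x

section Attainment

variable {X Y : Type*} [MetricSpace X] [CompactSpace X] [MeasurableSpace X] [BorelSpace X]
  [MetricSpace Y] [CompactSpace Y] [MeasurableSpace Y] [BorelSpace Y]

omit [MeasurableSpace X] [BorelSpace X] in
theorem isCompact_setOf_lipschitzWith_norm_le (L : NNReal) (M : ℝ) :
    IsCompact {f : BoundedContinuousFunction X ℝ | LipschitzWith L f ∧ ∀ x, ‖f x‖ ≤ M} := by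
  have hL : IsClosed {f : BoundedContinuousFunction X ℝ | LipschitzWith L f} := by
    have := (isClosed_setOfPred_lipschitzWith (α := X) (β := ℝ) L).preimage
      (BoundedContinuousFunction.continuous_coe (α := X) (β := ℝ))
    exact this
  have hM : IsClosed {f : BoundedContinuousFunction X ℝ | ∀ x, ‖f x‖ ≤ M} := by
    have : {f : BoundedContinuousFunction X ℝ | ∀ x, ‖f x‖ ≤ M} =
        ⋂ x, {f : BoundedContinuousFunction X ℝ | ‖f x‖ ≤ M} := by ext; simp
    rw [this]
    exact isClosed_iInter fun x => isClosed_le (continuous_eval_const x).norm continuous_const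
  refine BoundedContinuousFunction.arzela_ascoli₂ (Metric.closedBall (0 : ℝ) M)
    (isCompact_closedBall 0 M) _ (hL.inter hM) (fun f x hf => ?_) ?_
  · exact mem_closedBall_zero_iff.2 (hf.2 x)
  · exact (LipschitzWith.uniformEquicontinuous _ L fun f => f.2.1).equicontinuous

omit [CompactSpace X] in
theorem BoundedContinuousFunction.continuous_integral (μ : Measure X) [IsProbabilityMeasure μ] :
    Continuous fun f : BoundedContinuousFunction X ℝ => ∫ x, f x ∂μ := by
  refine (LipschitzWith.of_dist_le_mul (K := 1) fun f g => ?_).continuous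
  rw [Real.dist_eq, ← integral_sub (f.integrable μ) (g.integrable μ), NNReal.coe_one, one_mul,
    dist_eq_norm, ← Real.norm_eq_abs]
  exact (f - g).norm_integral_le_norm μ

/-- Any admissible pair of the dual problem can be improved to an equi-Lipschitz and bounded one. -/
theorem exists_lipschitz_dual_improvement (μ : Measure X) (ν : Measure Y)
    [IsProbabilityMeasure μ] [IsProbabilityMeasure ν] (c : C(X × Y, ℝ)) {L : NNReal}
    (h1 : ∀ y, LipschitzWith L fun x => c (x, y)) (h2 : ∀ x, LipschitzWith L fun y => c (x, y))
    (φ : C(X, ℝ)) (ψ : C(Y, ℝ)) (h : ∀ x y, φ x + ψ y ≤ c (x, y)) :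
    ∃ (φ' : BoundedContinuousFunction X ℝ) (ψ' : BoundedContinuousFunction Y ℝ),
      (LipschitzWith L φ' ∧ ∀ x, ‖φ' x‖ ≤ L * Metric.diam (univ : Set X)) ∧
      (LipschitzWith L ψ' ∧ ∀ y, ‖ψ' y‖ ≤ ‖c‖ + L * Metric.diam (univ : Set X)) ∧
      (∀ x y, φ' x + ψ' y ≤ c (x, y)) ∧
      ∫ x, φ x ∂μ + ∫ y, ψ y ∂ν ≤ ∫ x, φ' x ∂μ + ∫ y, ψ' y ∂ν := by
  obtain ⟨x₀⟩ : Nonempty X := nonempty_of_isProbabilityMeasure μ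
  have : Nonempty X := ⟨x₀⟩
  have : Nonempty Y := nonempty_of_isProbabilityMeasure ν
  have hc : ∀ z, |c z| ≤ ‖c‖ := fun z => c.norm_coe_le_norm z
  have hb1 : ∀ x, BddBelow (range fun y => c (x, y) - ψ y) := fun x =>
    ⟨φ x, by rintro _ ⟨y, rfl⟩; have := h x y; simp only; linarith⟩
  -- Two transforms in turn: each is the largest partner of the other potential, and inherits the
  -- Lipschitz constant of the cost.
  set f : X → ℝ := fun x => ⨅ y, (c (x, y) - ψ y)
  have hf : LipschitzWith L f := LipschitzWith.iInf_of_bddBelow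
    (fun y => LipschitzWith.of_le_add_mul L fun x x' => by
      have := (h1 y).dist_le_mul x x'
      rw [Real.dist_eq] at this
      linarith [le_abs_self (c (x, y) - c (x', y))]) hb1
  -- Moving a constant from one potential to the other changes nothing, so `f` is normalized to
  -- vanish at `x₀`; this gives the uniform bounds that compactness needs.
  have hfd : ∀ x, |f x - f x₀| ≤ L * Metric.diam (univ : Set X) := fun x => by
    rw [← Real.dist_eq]
    refine (hf.dist_le_mul x x₀).trans ?_
    gcongr
    exact Metric.dist_le_diam_of_mem isCompact_univ.isBounded (mem_univ _) (mem_univ _)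
  have hb2 : ∀ y, BddBelow (range fun x => c (x, y) - (f x - f x₀)) := fun y =>
    ⟨-‖c‖ - L * Metric.diam (univ : Set X), by
      rintro _ ⟨x, rfl⟩
      have := (abs_le.1 (hc (x, y))).1
      have := (abs_le.1 (hfd x)).2
      simp only
      linarith⟩
  set g : Y → ℝ := fun y => ⨅ x, (c (x, y) - (f x - f x₀))
  have hg : LipschitzWith L g := LipschitzWith.iInf_of_bddBelow
    (fun x => LipschitzWith.of_le_add_mul L fun y y' => by
      have := (h2 x).dist_le_mul y y'
      rw [Real.dist_eq] at this
      linarith [le_abs_self (c (x, y) - c (x, y'))]) hb2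
  have hg_le : ∀ x y, g y ≤ c (x, y) - (f x - f x₀) := fun x y => ciInf_le (hb2 y) x
  have hf_le : ∀ x y, f x ≤ c (x, y) - ψ y := fun x y => ciInf_le (hb1 x) y
  have hφ : ∀ x, φ x ≤ f x := fun x => le_ciInf fun y => by linarith [h x y]
  have hψ : ∀ y, ψ y + f x₀ ≤ g y := fun y => le_ciInf fun x => by linarith [hf_le x y]
  have hf' : LipschitzWith L fun x => f x - f x₀ :=
    LipschitzWith.of_le_add_mul L fun x x' => by
      have := hf.dist_le_mul x x'
      rw [Real.dist_eq] at this
      linarith [le_abs_self (f x - f x')]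
  refine ⟨.mkOfCompact ⟨_, hf'.continuous⟩, .mkOfCompact ⟨g, hg.continuous⟩, ⟨hf', hfd⟩,
    ⟨hg, fun y => abs_le.2 ⟨?_, ?_⟩⟩, fun x y => ?_, ?_⟩
  · refine le_ciInf fun x => ?_
    have := (abs_le.1 (hc (x, y))).1
    have := (abs_le.1 (hfd x)).2
    linarith
  · have := hg_le x₀ y
    have := (abs_le.1 (hc (x₀, y))).2
    have : 0 ≤ L * Metric.diam (univ : Set X) := mul_nonneg L.2 Metric.diam_nonneg
    simp only [BoundedContinuousFunction.mkOfCompact_apply, ContinuousMap.coe_mk]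
    linarith
  · have := hg_le x y
    simp only [BoundedContinuousFunction.mkOfCompact_apply, ContinuousMap.coe_mk]
    linarith
  · simp only [BoundedContinuousFunction.mkOfCompact_apply, ContinuousMap.coe_mk]
    have i1 : Integrable f μ := ContinuousMap.integrable_of_compactSpace μ ⟨f, hf.continuous⟩
    have i2 : Integrable g ν := ContinuousMap.integrable_of_compactSpace ν ⟨g, hg.continuous⟩
    have j1 : ∫ x, φ x ∂μ ≤ ∫ x, f x ∂μ :=
      integral_mono (φ.integrable_of_compactSpace μ) i1 hφ
    have j2 : ∫ y, (ψ y + f x₀) ∂ν ≤ ∫ y, g y ∂ν :=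
      integral_mono ((ψ.integrable_of_compactSpace ν).add (integrable_const _)) i2 hψ
    rw [integral_add (ψ.integrable_of_compactSpace ν) (integrable_const _)] at j2
    rw [integral_sub i1 (integrable_const _)]
    simp only [integral_const, probReal_univ, one_smul] at j2 ⊢
    linarith

/-- Kantorovich duality with attainment on both sides, for an equi-Lipschitz cost. -/
theorem exists_plan_eq_dual (μ : Measure X) (ν : Measure Y) [IsProbabilityMeasure μ]
    [IsProbabilityMeasure ν] (c : C(X × Y, ℝ)) {L : NNReal}
    (h1 : ∀ y, LipschitzWith L fun x => c (x, y)) (h2 : ∀ x, LipschitzWith L fun y => c (x, y)) :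
    ∃ (π : Measure (X × Y)) (φ : C(X, ℝ)) (ψ : C(Y, ℝ)), π.fst = μ ∧ π.snd = ν ∧
      (∀ x y, φ x + ψ y ≤ c (x, y)) ∧ ∫ z, c z ∂π = ∫ x, φ x ∂μ + ∫ y, ψ y ∂ν := by
  obtain ⟨π, hπ1, hπ2, hπ⟩ := exists_plan_forall_lt_dual μ ν c
  have : IsFiniteMeasure π := ⟨by
    rw [← Measure.fst_univ, hπ1]
    exact measure_lt_top μ univ⟩
  set B : ℝ := L * Metric.diam (univ : Set X)
  have hcomp := (isCompact_setOf_lipschitzWith_norm_le (X := X) L B).prod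
    (isCompact_setOf_lipschitzWith_norm_le (X := Y) L (‖c‖ + B))
  have hclosed : IsClosed {w : BoundedContinuousFunction X ℝ × BoundedContinuousFunction Y ℝ |
      ∀ x y, w.1 x + w.2 y ≤ c (x, y)} := by
    have : {w : BoundedContinuousFunction X ℝ × BoundedContinuousFunction Y ℝ |
        ∀ x y, w.1 x + w.2 y ≤ c (x, y)} = ⋂ x, ⋂ y,
        {w : BoundedContinuousFunction X ℝ × BoundedContinuousFunction Y ℝ |
          w.1 x + w.2 y ≤ c (x, y)} := by ext; simp
    rw [this]
    refine isClosed_iInter fun x => isClosed_iInter fun y => isClosed_le ?_ continuous_const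
    exact ((continuous_eval_const x).comp continuous_fst).add
      ((continuous_eval_const y).comp continuous_snd)
  -- Any `a` will do: the point is only that some admissible pair exists, so that the compact set is
  -- nonempty.
  obtain ⟨a, ha⟩ := exists_lt (∫ z, c z ∂π)
  obtain ⟨φ₀, ψ₀, h₀, -⟩ := hπ a ha
  obtain ⟨φ₁, ψ₁, k1, k2, k3, -⟩ := exists_lipschitz_dual_improvement μ ν c h1 h2 φ₀ ψ₀ h₀
  obtain ⟨w, hw, hmax⟩ := (hcomp.inter_right hclosed).exists_isMaxOn ⟨(φ₁, ψ₁), ⟨k1, k2⟩, k3⟩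
    (f := fun w => ∫ x, w.1 x ∂μ + ∫ y, w.2 y ∂ν)
    (((BoundedContinuousFunction.continuous_integral μ).comp continuous_fst).add
      ((BoundedContinuousFunction.continuous_integral ν).comp continuous_snd)).continuousOn
  refine ⟨π, w.1.toContinuousMap, w.2.toContinuousMap, hπ1, hπ2, hw.2, le_antisymm ?_ ?_⟩
  · refine le_of_forall_lt fun a ha => ?_
    obtain ⟨φ, ψ, h, hlt⟩ := hπ a ha
    obtain ⟨φ', ψ', k1, k2, k3, hle⟩ := exists_lipschitz_dual_improvement μ ν c h1 h2 φ ψ h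
    exact hlt.trans_le (hle.trans (hmax (a := (φ', ψ')) ⟨⟨k1, k2⟩, k3⟩))
  · exact integral_add_le_integral_of_marginals hπ1 hπ2 c _ _ hw.2

/-- Complementary slackness: potentials with the same value as a plan saturate the constraint
almost everywhere for this plan. -/
theorem ae_add_eq_of_integral_le_dual {μ : Measure X} {ν : Measure Y} {π : Measure (X × Y)}
    [IsFiniteMeasure π] (hπ1 : π.fst = μ) (hπ2 : π.snd = ν)
    (c : C(X × Y, ℝ)) (φ : C(X, ℝ)) (ψ : C(Y, ℝ)) (h : ∀ x y, φ x + ψ y ≤ c (x, y))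
    (hle : ∫ z, c z ∂π ≤ ∫ x, φ x ∂μ + ∫ y, ψ y ∂ν) :
    ∀ᵐ z ∂π, φ z.1 + ψ z.2 = c z := by
  refine (integral_eq_iff_of_ae_le ?_ (c.integrable_of_compactSpace π)
    (.of_forall fun z => h z.1 z.2)).1 (le_antisymm ?_ ?_)
  · exact ((φ.comp ContinuousMap.fst).integrable_of_compactSpace π).add
      ((ψ.comp ContinuousMap.snd).integrable_of_compactSpace π)
  · rw [integral_add_of_marginals hπ1 hπ2]
    exact integral_add_le_integral_of_marginals hπ1 hπ2 c φ ψ h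
  · rwa [integral_add_of_marginals hπ1 hπ2]

end Attainment

/-! ### Inverting the gradient of the power cost -/

section NormPow

variable {E : Type*} [NormedAddCommGroup E] [InnerProductSpace ℝ E]

/-- The inverse of the gradient `v ↦ (p * ‖v‖ ^ (p - 2)) • v` of `‖·‖ ^ p`. -/
noncomputable def normRpowGradInv (p : ℝ) (g : E) : E :=
  ((‖g‖ / p) ^ (p - 1)⁻¹ * ‖g‖⁻¹) • g

theorem normRpowGradInv_smul {p : ℝ} (hp : 1 < p) (v : E) :
    normRpowGradInv p ((p * ‖v‖ ^ (p - 2)) • v) = v := by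
  rcases eq_or_ne v 0 with rfl | hv
  · simp [normRpowGradInv]
  have hv0 : 0 < ‖v‖ := norm_pos_iff.2 hv
  have hp0 : 0 < p := by linarith
  have hpow : 0 < ‖v‖ ^ (p - 2) := Real.rpow_pos_of_pos hv0 _
  have hn : ‖(p * ‖v‖ ^ (p - 2)) • v‖ = p * ‖v‖ ^ (p - 1) := by
    rw [norm_smul, Real.norm_of_nonneg (by positivity), mul_assoc]
    congr 1
    rw [← Real.rpow_add_one hv0.ne']
    ring_nf
  have hd : (p * ‖v‖ ^ (p - 1) / p) ^ (p - 1)⁻¹ = ‖v‖ := by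
    rw [mul_div_cancel_left₀ _ hp0.ne', ← Real.rpow_mul hv0.le,
      mul_inv_cancel₀ (by linarith), Real.rpow_one]
  have hs : ‖v‖ ^ (p - 1) = ‖v‖ ^ (p - 2) * ‖v‖ := by
    rw [← Real.rpow_add_one hv0.ne']
    ring_nf
  rw [normRpowGradInv, hn, hd, smul_smul, hs]
  convert one_smul ℝ v using 2
  field_simp

theorem measurable_normRpowGradInv [MeasurableSpace E] [BorelSpace E]
    [SecondCountableTopology E] (p : ℝ) : Measurable (normRpowGradInv p : E → E) := by
  unfold normRpowGradInv
  exact (((measurable_norm.div_const p).pow_const _).mul measurable_norm.inv).smul measurable_id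

/-- Fermat's rule: at the minimum the gradient of `f` equals that of `‖· - y‖ ^ p`, and inverting
the latter recovers `x - y`. -/
theorem eq_sub_normRpowGradInv_gradient [CompleteSpace E] {p : ℝ} (hp : 1 < p) {f : E → ℝ}
    {x y : E} (hf : DifferentiableAt ℝ f x)
    (hmin : ∀ x', ‖x - y‖ ^ p - f x ≤ ‖x' - y‖ ^ p - f x') :
    y = x - normRpowGradInv p (gradient f x) := by
  have h1 : HasFDerivAt (fun x' => ‖x' - y‖ ^ p) ((p * ‖x - y‖ ^ (p - 2)) • innerSL ℝ (x - y)) x :=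
    HasFDerivAt.comp (g := fun v : E => ‖v‖ ^ p) (f := fun x' : E => x' - y) x
      (hasFDerivAt_norm_rpow (x - y) hp) ((hasFDerivAt_id x).sub_const y)
  have h2 := IsLocalMin.hasFDerivAt_eq_zero
    (f := fun x' => ‖x' - y‖ ^ p - f x') (.of_forall hmin) (h1.sub hf.hasFDerivAt)
  have h3 : gradient f x = (p * ‖x - y‖ ^ (p - 2)) • (x - y) := by
    rw [gradient, ← sub_eq_zero.1 h2, ← (InnerProductSpace.toDual ℝ E).symm_apply_apply
      ((p * ‖x - y‖ ^ (p - 2)) • (x - y))]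
    congr 1
    ext w
    simp
  rw [h3, normRpowGradInv_smul hp, sub_sub_cancel]

theorem measurable_gradient [CompleteSpace E] [MeasurableSpace E] [BorelSpace E] (f : E → ℝ) :
    Measurable (gradient f) :=
  (InnerProductSpace.toDual ℝ E).symm.continuous.measurable.comp (measurable_fderiv ℝ f)

theorem exists_lipschitzOnWith_norm_rpow [FiniteDimensional ℝ E] {p : ℝ} (hp : 1 < p) (r : ℝ) :
    ∃ L : NNReal, LipschitzOnWith L (fun v : E => ‖v‖ ^ p) (Metric.closedBall 0 r) := by
  have := FiniteDimensional.proper_real E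
  exact (contDiff_norm_rpow hp).contDiffOn.exists_lipschitzOnWith one_ne_zero
    (convex_closedBall 0 r) (isCompact_closedBall 0 r)

omit [InnerProductSpace ℝ E] in
theorem LipschitzOnWith.norm_sub_rpow {p r : ℝ} {L : NNReal}
    (hL : LipschitzOnWith L (fun v : E => ‖v‖ ^ p) (Metric.closedBall 0 (r + r))) {y : E}
    (hy : ‖y‖ ≤ r) :
    LipschitzOnWith L (fun x => ‖x - y‖ ^ p) (Metric.closedBall 0 r) := by
  refine LipschitzOnWith.of_dist_le_mul fun x hx x' hx' => ?_
  have hmem : ∀ w ∈ Metric.closedBall (0 : E) r, w - y ∈ Metric.closedBall (0 : E) (r + r) := by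
    intro w hw
    rw [mem_closedBall_zero_iff] at hw ⊢
    exact (_root_.norm_sub_le w y).trans (add_le_add hw hy)
  simpa using hL.dist_le_mul (x - y) (hmem x hx) (x' - y) (hmem x' hx')

end NormPow

/-! ### Rademacher's theorem for the transformed potential -/

section Potential

variable {E : Type*} [NormedAddCommGroup E] [InnerProductSpace ℝ E] [FiniteDimensional ℝ E]
  [MeasurableSpace E] [BorelSpace E]

/-- The transform of a potential on a compact set for the cost `‖x - y‖ ^ p` is differentiable
almost everywhere. -/
theorem ae_differentiableAt_iInf_norm_sub_rpow (m : Measure E) [m.IsAddHaarMeasure]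
    {K : Set E} [Nonempty K] (hK : Bornology.IsBounded K) {p : ℝ} (hp : 1 < p) (ψ : K → ℝ)
    (hψ : BddAbove (range ψ)) :
    ∀ᵐ x ∂m, DifferentiableAt ℝ (fun x => ⨅ y : K, (‖x - (y : E)‖ ^ p - ψ y)) x := by
  obtain ⟨b, hb⟩ := hψ
  obtain ⟨r₀, hr₀⟩ := hK.exists_norm_le
  -- The cost is Lipschitz only on bounded sets, so Rademacher is applied on each ball of a
  -- countable exhaustion.
  have hball : ∀ n : ℕ, ∀ᵐ x ∂m, x ∈ Metric.ball (0 : E) n →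
      DifferentiableAt ℝ (fun x => ⨅ y : K, (‖x - (y : E)‖ ^ p - ψ y)) x := by
    intro n
    obtain ⟨L, hL⟩ := exists_lipschitzOnWith_norm_rpow (E := E) hp (max r₀ n + max r₀ n)
    have hlip : LipschitzOnWith L (fun x => ⨅ y : K, (‖x - (y : E)‖ ^ p - ψ y))
        (Metric.ball (0 : E) n) := by
      refine LipschitzOnWith.iInf_of_bddBelow (fun y => ?_) fun x _ => ⟨-b, ?_⟩
      · have h := (hL.norm_sub_rpow ((hr₀ y y.2).trans (le_max_left _ _))).mono
          (Metric.ball_subset_closedBall.trans (Metric.closedBall_subset_closedBall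
            (le_max_right r₀ (n : ℝ))))
        refine LipschitzOnWith.of_dist_le_mul fun x hx x' hx' => ?_
        simpa using h.dist_le_mul x hx x' hx'
      · rintro _ ⟨y, rfl⟩
        have h1 : ψ y ≤ b := hb ⟨y, rfl⟩
        have h2 : 0 ≤ ‖x - (y : E)‖ ^ p := by positivity
        simp only
        linarith
    filter_upwards [hlip.ae_differentiableWithinAt_of_mem (μ := m)] with x hx hxn
    exact (hx hxn).differentiableAt (Metric.isOpen_ball.mem_nhds hxn)
  filter_upwards [ae_all_iff.2 hball] with x hx
  obtain ⟨n, hn⟩ := exists_nat_gt ‖x‖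
  exact hx n (mem_ball_zero_iff.2 hn)

end Potential

/-! ### All optimal plans lie on one graph -/

section OptimalMap

variable {d : ℕ} {K : Set (EuclideanSpace ℝ (Fin d))}

theorem RegGAN.measurable_powCost (p : ℝ) :
    Measurable fun z : K × K => RegGAN.powCost K p z.1 z.2 := by
  unfold RegGAN.powCost
  fun_prop

/-- For the cost `‖x - y‖ ^ p` on a compact set and an absolutely continuous source, there is an
optimal plan, and all optimal plans are carried by the graph of one and the same measurable map. -/
theorem RegGAN.exists_optimal_plan_and_map (hK : IsCompact K) {p : ℝ} (hp : 1 < p)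
    (μ ν : Measure K) [IsProbabilityMeasure μ] [IsProbabilityMeasure ν]
    (hμ : μ.map (Subtype.val : K → EuclideanSpace ℝ (Fin d)) ≪ volume) :
    ∃ (π₀ : Measure (K × K)) (T : K → K), π₀.fst = μ ∧ π₀.snd = ν ∧ Measurable T ∧
      ∫⁻ z, RegGAN.powCost K p z.1 z.2 ∂π₀ ≠ ∞ ∧
      (∀ π : Measure (K × K), π.fst = μ → π.snd = ν →
        ∫⁻ z, RegGAN.powCost K p z.1 z.2 ∂π₀ ≤ ∫⁻ z, RegGAN.powCost K p z.1 z.2 ∂π) ∧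
      ∀ π : Measure (K × K), π.fst = μ → π.snd = ν →
        ∫⁻ z, RegGAN.powCost K p z.1 z.2 ∂π ≤ ∫⁻ z, RegGAN.powCost K p z.1 z.2 ∂π₀ →
          ∀ᵐ z ∂π, z.2 = T z.1 := by
  have : CompactSpace K := isCompact_iff_compactSpace.1 hK
  have hp0 : 0 ≤ p := by linarith
  have : Nonempty K := nonempty_of_isProbabilityMeasure μ
  obtain ⟨r, hr⟩ := hK.isBounded.exists_norm_le
  obtain ⟨L, hL⟩ := exists_lipschitzOnWith_norm_rpow
    (E := EuclideanSpace ℝ (Fin d)) hp (r + r)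
  let c : C(K × K, ℝ) := ⟨fun z => ‖(z.1 : EuclideanSpace ℝ (Fin d)) - z.2‖ ^ p,
    (continuous_norm.rpow_const fun _ => Or.inr hp0).comp
      ((continuous_subtype_val.comp continuous_fst).sub
        (continuous_subtype_val.comp continuous_snd))⟩
  have hc1 : ∀ y, LipschitzWith L fun x => c (x, y) := fun y =>
    LipschitzWith.of_dist_le_mul fun x x' => (hL.norm_sub_rpow (hr y y.2)).dist_le_mul
      x (mem_closedBall_zero_iff.2 (hr x x.2)) x' (mem_closedBall_zero_iff.2 (hr x' x'.2))
  have hc2 : ∀ x, LipschitzWith L fun y => c (x, y) := fun x =>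
    LipschitzWith.of_dist_le_mul fun y y' => by
      have := (hc1 x).dist_le_mul y y'
      simpa only [c, ContinuousMap.coe_mk, norm_sub_rev] using this
  obtain ⟨π₀, φ, ψ, hπ1, hπ2, hadm, heq⟩ := exists_plan_eq_dual μ ν c hc1 hc2
  have hfin : ∀ π : Measure (K × K), π.fst = μ → IsFiniteMeasure π := fun π h => ⟨by
    rw [← Measure.fst_univ, h]
    exact measure_lt_top μ univ⟩
  have hlint : ∀ π : Measure (K × K), π.fst = μ →
      ∫⁻ z, RegGAN.powCost K p z.1 z.2 ∂π = ENNReal.ofReal (∫ z, c z ∂π) := fun π h => by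
    have := hfin π h
    rw [ofReal_integral_eq_lintegral_ofReal (c.integrable_of_compactSpace π)
      (.of_forall fun z => Real.rpow_nonneg (norm_nonneg _) p)]
    rfl
  have hc0 : ∀ π : Measure (K × K), 0 ≤ ∫ z, c z ∂π := fun π =>
    integral_nonneg fun z => Real.rpow_nonneg (norm_nonneg _) p
  -- The infimum over `y ∈ K` makes sense for `x` in the whole space, so the first-order condition
  -- also holds at points of the frontier of `K`.
  set f : EuclideanSpace ℝ (Fin d) → ℝ := fun x => ⨅ y : K, (‖x - y‖ ^ p - ψ y) with hf
  have hψ : BddAbove (range ψ) := (isCompact_range ψ.continuous).bddAbove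
  have hfle : ∀ x (y : K), f x ≤ ‖x - y‖ ^ p - ψ y := by
    intro x y
    obtain ⟨b, hb⟩ := hψ
    refine ciInf_le ⟨-b, ?_⟩ y
    rintro _ ⟨y, rfl⟩
    have h1 : ψ y ≤ b := hb ⟨y, rfl⟩
    have h2 : 0 ≤ ‖x - y‖ ^ p := by positivity
    simp only
    linarith
  have hφf : ∀ x : K, φ x ≤ f x := fun x => le_ciInf fun y => by
    have : φ x + ψ y ≤ ‖(x : EuclideanSpace ℝ (Fin d)) - y‖ ^ p := hadm x y
    linarith
  have hdiff : ∀ᵐ x : K ∂μ, DifferentiableAt ℝ f x :=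
    ae_of_ae_map measurable_subtype_coe.aemeasurable
      (hμ.ae_le (ae_differentiableAt_iInf_norm_sub_rpow volume hK.isBounded hp ψ hψ))
  have hemb : MeasurableEmbedding (Subtype.val : K → EuclideanSpace ℝ (Fin d)) :=
    MeasurableEmbedding.subtype_coe hK.measurableSet
  obtain ⟨x₀⟩ := ‹Nonempty K›
  -- The formula for `y` takes values in the ambient space; points outside `K` are sent to the
  -- arbitrary `x₀`.
  refine ⟨π₀, fun x => Function.extend Subtype.val id (fun _ => x₀)
    ((x : EuclideanSpace ℝ (Fin d)) - normRpowGradInv p (gradient f x)), hπ1, hπ2, ?_,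
    (hlint π₀ hπ1).trans_ne ENNReal.ofReal_ne_top, ?_, ?_⟩
  · exact (hemb.measurable_extend measurable_id measurable_const).comp
      (measurable_subtype_coe.sub ((measurable_normRpowGradInv p).comp
        ((measurable_gradient f).comp measurable_subtype_coe)))
  · intro π h1 h2
    have := hfin π h1
    rw [hlint π h1, hlint π₀ hπ1, heq]
    exact ENNReal.ofReal_le_ofReal (integral_add_le_integral_of_marginals h1 h2 c φ ψ hadm)
  · intro π h1 h2 hle
    have := hfin π h1
    rw [hlint π h1, hlint π₀ hπ1, ENNReal.ofReal_le_ofReal_iff (hc0 π₀), heq] at hle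
    have hdiff' : ∀ᵐ z ∂π, DifferentiableAt ℝ f (z.1 : EuclideanSpace ℝ (Fin d)) := by
      rw [← h1] at hdiff
      exact ae_of_ae_map measurable_fst.aemeasurable hdiff
    filter_upwards [ae_add_eq_of_integral_le_dual h1 h2 c φ ψ hadm hle, hdiff'] with z hz hd
    have hz' : φ z.1 + ψ z.2 = ‖(z.1 : EuclideanSpace ℝ (Fin d)) - z.2‖ ^ p := hz
    -- Since `φ ≤ f`, slackness gives `‖x - y‖ ^ p - f x ≤ ψ y`, and `ψ y ≤ ‖x' - y‖ ^ p - f x'` for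
    -- every `x'`.
    have key := eq_sub_normRpowGradInv_gradient hp (y := (z.2 : EuclideanSpace ℝ (Fin d))) hd
      fun x' => by linarith [hφf z.1, hfle x' z.2]
    rw [← key, hemb.injective.extend_apply, id]

end OptimalMap

/-! ### From plans to maps, and the two objectives -/

namespace RegGAN

section Monge

variable {X Y : Type*} [MeasurableSpace X] [MeasurableSpace Y]

theorem fst_map_graph (P : ProbabilityMeasure X) (T : MeasMap X Y) :
    ((P : Measure X).map fun x => (x, T.1 x)).fst = P := by
  rw [Measure.fst, Measure.map_map measurable_fst (measurable_id'.prodMk T.2)]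
  exact Measure.map_id

theorem snd_map_graph (P : ProbabilityMeasure X) (T : MeasMap X Y) :
    ((P : Measure X).map fun x => (x, T.1 x)).snd = (pushforward P T : Measure Y) := by
  rw [Measure.snd, Measure.map_map measurable_snd (measurable_id'.prodMk T.2)]
  rfl

theorem lintegral_map_graph {c : X → Y → ℝ≥0∞} (hc : Measurable fun z : X × Y => c z.1 z.2)
    (P : ProbabilityMeasure X) (T : MeasMap X Y) :
    ∫⁻ z, c z.1 z.2 ∂((P : Measure X).map fun x => (x, T.1 x)) = contentLoss c P T :=
  lintegral_map hc (measurable_id'.prodMk T.2)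

theorem kantorovichCost_le_contentLoss {c : X → Y → ℝ≥0∞}
    (hc : Measurable fun z : X × Y => c z.1 z.2) (P : ProbabilityMeasure X) (T : MeasMap X Y) :
    kantorovichCost c P (pushforward P T) ≤ contentLoss c P T := by
  rw [← lintegral_map_graph hc]
  exact iInf_le_of_le _ (iInf_le_of_le (fst_map_graph P T)
    (iInf_le_of_le (snd_map_graph P T) le_rfl))

theorem distObjective_pushforward_le {c : X → Y → ℝ≥0∞}
    (hc : Measurable fun z : X × Y => c z.1 z.2)
    (D : ProbabilityMeasure Y → ProbabilityMeasure Y → ℝ≥0∞) (lam : ℝ)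
    (P : ProbabilityMeasure X) (Q : ProbabilityMeasure Y) (T : MeasMap X Y) :
    distObjective D lam c P Q (pushforward P T) ≤ ganObjective D lam c P Q T := by
  unfold distObjective ganObjective
  gcongr
  exact kantorovichCost_le_contentLoss hc P T

theorem ganObjective_eq_distObjective {c : X → Y → ℝ≥0∞}
    (D : ProbabilityMeasure Y → ProbabilityMeasure Y → ℝ≥0∞) (lam : ℝ)
    (P : ProbabilityMeasure X) (Q : ProbabilityMeasure Y) {T : MeasMap X Y}
    {R : ProbabilityMeasure Y} (hT : pushforward P T = R)
    (h : contentLoss c P T = kantorovichCost c P R) :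
    ganObjective D lam c P Q T = distObjective D lam c P Q R := by
  rw [ganObjective, distObjective, hT, h]

end Monge

/-- Existence and uniqueness of the optimal transport map for the cost `‖x - y‖ ^ p`, `p > 1`, on a
compact set and an absolutely continuous source. -/
theorem exists_unique_optimal_map {d : ℕ} {K : Set (EuclideanSpace ℝ (Fin d))} (hK : IsCompact K)
    {p : ℝ} (hp : 1 < p) (P R : ProbabilityMeasure K)
    (hP : (P : Measure K).map (Subtype.val : K → EuclideanSpace ℝ (Fin d)) ≪ volume) :
    kantorovichCost (powCost K p) P R ≠ ∞ ∧ ∃ T : MeasMap K K, pushforward P T = R ∧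
      contentLoss (powCost K p) P T = kantorovichCost (powCost K p) P R ∧
      ∀ T' : MeasMap K K, pushforward P T' = R →
        contentLoss (powCost K p) P T' = kantorovichCost (powCost K p) P R →
        T'.1 =ᵐ[(P : Measure K)] T.1 := by
  obtain ⟨π, T, h1, h2, hT, hfin, hopt, hgraph⟩ :=
    exists_optimal_plan_and_map hK hp (P : Measure K) (R : Measure K) hP
  have hcost : kantorovichCost (powCost K p) P R = ∫⁻ z, powCost K p z.1 z.2 ∂π :=
    le_antisymm (iInf_le_of_le π (iInf_le_of_le h1 (iInf_le_of_le h2 le_rfl)))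
      (le_iInf fun π' => le_iInf fun h1' => le_iInf fun h2' => hopt π' h1' h2')
  -- A plan carried by a graph is determined by its first marginal.
  have hπ : π = (P : Measure K).map fun x => (x, T x) := by
    calc π = π.map id := Measure.map_id.symm
      _ = π.map ((fun x => (x, T x)) ∘ Prod.fst) := Measure.map_congr (by
        filter_upwards [hgraph π h1 h2 le_rfl] with z hz
        exact Prod.ext rfl hz)
      _ = (P : Measure K).map fun x => (x, T x) := by
        rw [← Measure.map_map (measurable_id'.prodMk hT) measurable_fst, ← h1]
        rfl
  refine ⟨hcost ▸ hfin, ⟨T, hT⟩, ?_, ?_, fun T' hT' hT'cost => ?_⟩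
  · apply Subtype.ext
    change (pushforward P ⟨T, hT⟩ : Measure K) = R
    rw [← snd_map_graph, ← h2, hπ]
  · rw [← lintegral_map_graph (measurable_powCost p), hcost, hπ]
  · refine ae_of_ae_map (p := fun z : K × K => z.2 = T z.1)
      (measurable_id'.prodMk T'.2).aemeasurable (hgraph _ (fst_map_graph P T') ?_ ?_)
    · rw [snd_map_graph, hT']
    · rw [lintegral_map_graph (measurable_powCost p), hT'cost, hcost]

end RegGAN

theorem lemma2 (d : ℕ) (K : Set (EuclideanSpace ℝ (Fin d)))
    (hK : IsCompact K) (hbd : volume (frontier K) = 0)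
    (D : ProbabilityMeasure K → ProbabilityMeasure K → ℝ≥0∞) (hD : ∀ R, D R R = 0)
    (P Q : ProbabilityMeasure K)
    (hP : (P : Measure K).map (Subtype.val : K → EuclideanSpace ℝ (Fin d)) ≪ volume)
    (p : ℝ) (hp : 1 < p) (lam : ℝ) (hlam : 0 < lam) :
    -- Monge's and Kantorovich's forms of the transport cost agree, so `Cost` is unambiguous
    (∀ R : ProbabilityMeasure K,
      RegGAN.mongeCost (RegGAN.powCost K p) P R =
        RegGAN.kantorovichCost (RegGAN.powCost K p) P R) ∧
    -- the two problems have the same value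
    (⨅ T : RegGAN.MeasMap K K, RegGAN.ganObjective D lam (RegGAN.powCost K p) P Q T) =
      (⨅ R : ProbabilityMeasure K, RegGAN.distObjective D lam (RegGAN.powCost K p) P Q R) ∧
    -- `T` is a minimizer iff `T_# P` is a minimizer and `T` is an optimal map from `P` to `T_# P`
    (∀ T : RegGAN.MeasMap K K,
      IsMinOn (RegGAN.ganObjective D lam (RegGAN.powCost K p) P Q) univ T ↔
        IsMinOn (RegGAN.distObjective D lam (RegGAN.powCost K p) P Q) univ
            (RegGAN.pushforward P T) ∧
          RegGAN.contentLoss (RegGAN.powCost K p) P T =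
            RegGAN.kantorovichCost (RegGAN.powCost K p) P (RegGAN.pushforward P T)) ∧
    -- each minimizer over distributions is `T_# P` for a minimizer `T`, unique `P`-a.e.
    (∀ R : ProbabilityMeasure K,
      IsMinOn (RegGAN.distObjective D lam (RegGAN.powCost K p) P Q) univ R →
        ∃ T : RegGAN.MeasMap K K,
          IsMinOn (RegGAN.ganObjective D lam (RegGAN.powCost K p) P Q) univ T ∧
          RegGAN.pushforward P T = R ∧
          ∀ T' : RegGAN.MeasMap K K,
            IsMinOn (RegGAN.ganObjective D lam (RegGAN.powCost K p) P Q) univ T' →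
            RegGAN.pushforward P T' = R → T'.1 =ᵐ[(P : Measure K)] T.1) := by
  have hc := RegGAN.measurable_powCost (K := K) p
  have hmap := fun R => RegGAN.exists_unique_optimal_map hK hp P R hP
  have hle := RegGAN.distObjective_pushforward_le hc D lam P Q
  have hex : ∀ R, ∃ T, RegGAN.ganObjective D lam (RegGAN.powCost K p) P Q T =
      RegGAN.distObjective D lam (RegGAN.powCost K p) P Q R := fun R => by
    obtain ⟨-, T, hT, hTc, -⟩ := hmap R
    exact ⟨T, RegGAN.ganObjective_eq_distObjective D lam P Q hT hTc⟩
  have hiff : ∀ T : RegGAN.MeasMap K K,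
      IsMinOn (RegGAN.ganObjective D lam (RegGAN.powCost K p) P Q) univ T ↔
        IsMinOn (RegGAN.distObjective D lam (RegGAN.powCost K p) P Q) univ
            (RegGAN.pushforward P T) ∧
          RegGAN.contentLoss (RegGAN.powCost K p) P T =
            RegGAN.kantorovichCost (RegGAN.powCost K p) P (RegGAN.pushforward P T) := by
    intro T
    simp only [isMinOn_univ_iff]
    constructor
    · intro h
      have hG : ∀ R, RegGAN.ganObjective D lam (RegGAN.powCost K p) P Q T ≤
          RegGAN.distObjective D lam (RegGAN.powCost K p) P Q R := fun R => by
        obtain ⟨S, hS⟩ := hex R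
        exact hS ▸ h S
      refine ⟨fun R => (hle T).trans (hG R), ?_⟩
      -- The competitor `Q` has `D Q Q = 0` and finite cost, so the minimum is finite and the term
      -- in `D` can be cancelled below; `lam > 0` then cancels too.
      have hfin : RegGAN.ganObjective D lam (RegGAN.powCost K p) P Q T ≠ ∞ := by
        refine ne_top_of_le_ne_top ?_ (hG Q)
        rw [RegGAN.distObjective, hD, zero_add]
        exact ENNReal.mul_ne_top ENNReal.ofReal_ne_top (hmap Q).1
      have heq := (hG (RegGAN.pushforward P T)).antisymm (hle T)
      rw [RegGAN.ganObjective] at hfin heq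
      rw [RegGAN.distObjective, ENNReal.add_right_inj (ENNReal.add_ne_top.1 hfin).1] at heq
      exact (ENNReal.mul_right_inj (ENNReal.ofReal_pos.2 hlam).ne' ENNReal.ofReal_ne_top).1 heq
    · rintro ⟨h, hT⟩ S
      rw [RegGAN.ganObjective_eq_distObjective D lam P Q rfl hT]
      exact (h _).trans (hle S)
  refine ⟨fun R => ?_, ?_, hiff, fun R hR => ?_⟩
  · obtain ⟨-, T, hT, hTc, -⟩ := hmap R
    refine le_antisymm (hTc ▸ iInf_le_of_le T (iInf_le_of_le hT le_rfl)) ?_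
    refine le_iInf fun S => le_iInf fun hS => ?_
    subst hS
    exact RegGAN.kantorovichCost_le_contentLoss hc P S
  · refine le_antisymm (le_iInf fun R => ?_) (le_iInf fun T => iInf_le_of_le _ (hle T))
    obtain ⟨T, hT⟩ := hex R
    exact iInf_le_of_le T hT.le
  · obtain ⟨-, T, rfl, hTc, huniq⟩ := hmap R
    exact ⟨T, (hiff T).2 ⟨hR, hTc⟩, rfl, fun T' hT' hT'R =>
      huniq T' hT'R (hT'R ▸ ((hiff T').1 hT').2)⟩
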